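/- Let $A$ be a finite alphabet. A monadic predicate is a family $\mathbf P=(\mathbf P_n)_{n\in\mathbb N}$ with $\mathbf P_n\subseteq\{0,\dots,n-1\}$; $\mathrm{Arb}_1$ denotes the class of all monadic predicates. A monadic predicate $\mathbf P$ is regular if the language over $\{0,1\}$ that contains, for each $n$, exactly one word of length $n$, namely the characteristic word of $\mathbf P_n$, is regular; $\mathcal Reg_1$ denotes the class of regular monadic predicates. Consider monadic second-order formulae over words in $A^*$, built from the atoms $\mathbf a(x)$ (the letter at position $x$ is $a$), $x\le y$, $x\in X$ and $P(x)$ with $P$ from an infinite supply of monadic predicate symbols, by conjunction, negation, first-order quantification $\exists x$ over positions, second-order quantification $\exists X$ over sets of positions, and modular quantification $\exists^{r,q}x$ with $q\ge 1$ ("the number of positions $x$ satisfying the formula is congruent to $r$ modulo $q$"). For a sentence $\varphi$ and an interpretation $\overline{\mathbf P}$ of its predicate symbols by monadic predicates, let $L_{\varphi,\overline{\mathbf P}}\subseteq A^*$ be the set of words that satisfy $\varphi$, where $P(x)$ holds in a word of length $n$ if the position $x$ belongs to $\mathbf P_n$. For a class $F$ of formulae and a class $\mathcal C$ of monadic predicates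 let $$F[\le,\mathcal C]=\{L_{\varphi,\overline{\mathbf P}} \mid \varphi\in F \text{ a sentence},\ \overline{\mathbf P}\in\mathcal C\}.$$ **Theorem.** For every class $F$ of such formulae, $F[\le,\mathrm{Arb}_1]$ has the Straubing property: its regular languages are exactly the languages of $F[\le,\mathcal Reg_1]$, that is, $$F[\le,\mathrm{Arb}_1]\cap\mathrm{REG}=F[\le,\mathcal Reg_1],$$ where $\mathrm{REG}$ is the class of regular languages over $A$. In particular, for every $k\ge 1$, $\mathcal B\Sigma_k[\le,\mathrm{Arb}_1]$ has the Straubing property, where $\mathcal B\Sigma_k$ is the class of Boolean combinations of first-order prenex formulae (without modular quantifiers) with at most $k$ alternating blocks of quantifiers, the outermost block being existential. -/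

import Mathlib

namespace AdviceMSO

/-- A monadic numerical predicate `P = (Pₙ)ₙ`, where `Pₙ ⊆ {0, …, n-1}`. The class of all of them
is `Set.univ : Set MonadicPredicate`. -/
abbrev MonadicPredicate : Type := ∀ n : ℕ, Set (Fin n)

/-- The predicate `P` seen as a language over the alphabet `{0, 1}`: it contains, for each length
`n`, exactly one word, the characteristic word of `Pₙ`. -/
def MonadicPredicate.language (P : MonadicPredicate) : Language Bool :=
  {w | ∀ i : Fin w.length, w.get i = true ↔ i ∈ P w.length}

/-- The class of regular monadic predicates. -/
def regularPredicates : Set MonadicPredicate :=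
  {P | P.language.IsRegular}

/-- Monadic second-order formulae over words on the alphabet `A`, with the ordering of positions,
monadic numerical predicate symbols and modular counting quantifiers. First-order variables,
second-order variables and predicate symbols are all named by natural numbers. -/
inductive Formula (A : Type*) where
  /-- `a(x)`: the letter at position `x` is `a`. -/
  | letter (a : A) (x : ℕ) : Formula A
  /-- `x ≤ y` -/
  | le (x y : ℕ) : Formula A
  /-- `x ∈ X` -/
  | mem (x X : ℕ) : Formula A
  /-- `P(x)`, where `P` is the `i`-th predicate symbol. -/
  | pred (i x : ℕ) : Formula A
  /-- `φ ∧ ψ` -/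
  | and (φ ψ : Formula A) : Formula A
  /-- `¬ φ` -/
  | neg (φ : Formula A) : Formula A
  /-- `∃ x, φ`, where `x` ranges over positions. -/
  | ex (x : ℕ) (φ : Formula A) : Formula A
  /-- `∃ X, φ`, where `X` ranges over sets of positions. -/
  | exSet (X : ℕ) (φ : Formula A) : Formula A
  /-- The number of positions `x` that satisfy `φ` is congruent to `r` modulo `q`. -/
  | exMod (r : ℕ) (q : ℕ+) (x : ℕ) (φ : Formula A) : Formula A

namespace Formula

variable {A : Type*}

/-- Free first-order variables. -/
def freeVars : Formula A → Finset ℕ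
  | letter _ x => {x}
  | le x y => {x, y}
  | mem x _ => {x}
  | pred _ x => {x}
  | and φ ψ => φ.freeVars ∪ ψ.freeVars
  | neg φ => φ.freeVars
  | ex x φ => φ.freeVars \ {x}
  | exSet _ φ => φ.freeVars
  | exMod _ _ x φ => φ.freeVars \ {x}

/-- Free second-order variables. -/
def freeSetVars : Formula A → Finset ℕ
  | letter _ _ => ∅
  | le _ _ => ∅
  | mem _ X => {X}
  | pred _ _ => ∅
  | and φ ψ => φ.freeSetVars ∪ ψ.freeSetVars
  | neg φ => φ.freeSetVars
  | ex _ φ => φ.freeSetVars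
  | exSet X φ => φ.freeSetVars \ {X}
  | exMod _ _ _ φ => φ.freeSetVars

/-- The predicate symbols that occur in a formula. -/
def predSymbols : Formula A → Finset ℕ
  | letter _ _ => ∅
  | le _ _ => ∅
  | mem _ _ => ∅
  | pred i _ => {i}
  | and φ ψ => φ.predSymbols ∪ ψ.predSymbols
  | neg φ => φ.predSymbols
  | ex _ φ => φ.predSymbols
  | exSet _ φ => φ.predSymbols
  | exMod _ _ _ φ => φ.predSymbols

/-- A sentence is a formula without free variables. -/
def IsSentence (φ : Formula A) : Prop :=
  φ.freeVars = ∅ ∧ φ.freeSetVars = ∅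

/-- `φ.Sat w P v V`: the formula `φ` holds in the word `w` when the predicate symbols are
interpreted by `P`, the free first-order variables by `v` and the free second-order variables
by `V`. Positions are the natural numbers `p < w.length`. Valuations are total functions into `ℕ`
so that they also exist for the empty word; quantifiers range over actual positions, and over sets
of actual positions, only. -/
def Sat (w : List A) (P : ℕ → MonadicPredicate) :
    (v : ℕ → ℕ) → (V : ℕ → Set ℕ) → Formula A → Prop
  | v, _, letter a x => w[v x]? = some a
  | v, _, le x y => v x ≤ v y
  | v, V, mem x X => v x ∈ V X
  | v, _, pred i x => ∃ h : v x < w.length, (⟨v x, h⟩ : Fin w.length) ∈ P i w.length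
  | v, V, and φ ψ => Sat w P v V φ ∧ Sat w P v V ψ
  | v, V, neg φ => ¬ Sat w P v V φ
  | v, V, ex x φ => ∃ p < w.length, Sat w P (Function.update v x p) V φ
  | v, V, exSet X φ => ∃ S ⊆ Set.Iio w.length, Sat w P v (Function.update V X S) φ
  | v, V, exMod r q x φ =>
      {p | p < w.length ∧ Sat w P (Function.update v x p) V φ}.ncard ≡ r [MOD (q : ℕ)]

/-- The language of all words that satisfy `φ` when the predicate symbols are interpreted by `P`.
It is used for sentences only, whose truth does not depend on the valuation of the variables. -/
def language (φ : Formula A) (P : ℕ → MonadicPredicate) : Language A :=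
  {w | φ.Sat w P (fun _ => 0) (fun _ => ∅)}

/-- Universal first-order quantification. -/
def all (x : ℕ) (φ : Formula A) : Formula A :=
  neg (ex x (neg φ))

/-- Quantifier-free first-order formulae. -/
inductive IsQuantifierFree : Formula A → Prop
  | letter (a : A) (x : ℕ) : IsQuantifierFree (letter a x)
  | le (x y : ℕ) : IsQuantifierFree (le x y)
  | pred (i x : ℕ) : IsQuantifierFree (pred i x)
  | and {φ ψ : Formula A} : IsQuantifierFree φ → IsQuantifierFree ψ → IsQuantifierFree (and φ ψ)
  | neg {φ : Formula A} : IsQuantifierFree φ → IsQuantifierFree (neg φ)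

mutual

/-- `Σₖ`: prenex first-order formulae with at most `k` alternating blocks of quantifiers, the
outermost one being existential. -/
inductive IsSigma : ℕ → Formula A → Prop
  | quantifierFree {k : ℕ} {φ : Formula A} : IsQuantifierFree φ → IsSigma k φ
  | ofPi {k : ℕ} {φ : Formula A} : IsPi k φ → IsSigma (k + 1) φ
  | ex {k : ℕ} {φ : Formula A} (x : ℕ) : IsSigma (k + 1) φ → IsSigma (k + 1) (ex x φ)

/-- `Πₖ`: prenex first-order formulae with at most `k` alternating blocks of quantifiers, the
outermost one being universal. -/
inductive IsPi : ℕ → Formula A → Prop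
  | quantifierFree {k : ℕ} {φ : Formula A} : IsQuantifierFree φ → IsPi k φ
  | ofSigma {k : ℕ} {φ : Formula A} : IsSigma k φ → IsPi (k + 1) φ
  | all {k : ℕ} {φ : Formula A} (x : ℕ) : IsPi (k + 1) φ → IsPi (k + 1) (all x φ)

end

/-- Boolean combinations of `Σₖ` formulae. -/
inductive IsBoolSigma (k : ℕ) : Formula A → Prop
  | sigma {φ : Formula A} : IsSigma k φ → IsBoolSigma k φ
  | and {φ ψ : Formula A} : IsBoolSigma k φ → IsBoolSigma k ψ → IsBoolSigma k (and φ ψ)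
  | neg {φ : Formula A} : IsBoolSigma k φ → IsBoolSigma k (neg φ)

end Formula

/-- The class `BΣₖ` of formulae. -/
def BoolSigma (A : Type*) (k : ℕ) : Set (Formula A) :=
  {φ | φ.IsBoolSigma k}

/-- The fragment `F[≤, 𝒞]`: the languages defined by the sentences of `F` whose predicate symbols
are interpreted by predicates from the class `𝒞`. -/
def fragment {A : Type*} (F : Set (Formula A)) (𝒞 : Set MonadicPredicate) : Set (Language A) :=
  {L | ∃ φ ∈ F, φ.IsSentence ∧
    ∃ P : ℕ → MonadicPredicate, (∀ i ∈ φ.predSymbols, P i ∈ 𝒞) ∧ φ.language P = L}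

/-- The Straubing property of `F[≤, 𝒞]`: its regular languages are exactly the languages of
`F[≤, 𝒞 ∩ Reg]`. -/
def StraubingProperty {A : Type*} (F : Set (Formula A)) (𝒞 : Set MonadicPredicate) : Prop :=
  fragment F 𝒞 ∩ {L | L.IsRegular} = fragment F (𝒞 ∩ regularPredicates)

end AdviceMSO

-- Fix a sentence and an interpretation that define a regular language `L`. Read the values of the
-- predicates on words of length `n` as a single advice word of length `n`. By Büchi's argument
-- (`exists_isRegular_encodes`), truth of the sentence is a regular property of the input and advice
-- words read in parallel. Hence the set `K` of good advice words, those with which the sentence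
-- decides `L` correctly on every input of their length, is regular too: it is a universal
-- projection. The given interpretation shows that `K` has a word of every length. Keeping only the
-- lexicographically least word of each length preserves regularity (`IsRegular.lexMin`), and every
-- track of these words is a regular predicate. The sentence itself never changes, which is why the
-- class `F` can be arbitrary.
--
-- Conversely, an automaton can guess regular advice, verify it and project it away
-- (`IsSentence.isRegular_language`).
--
-- Letters carry infinitely many tracks, so the alphabets are infinite; regularity only asks for
-- finitely many states, and the closure properties below need no more.

-- Closure properties of regular languages over arbitrary alphabets

namespace Language

variable {α β : Type*}

/-- A language is regular as soon as membership of `u ++ v` depends on `u` only through finitely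
many states. -/
theorem isRegular_of_finite_states {τ : Type*} [Finite τ] {L : Language α} (g : List α → τ)
    (h : ∀ u u' v, g u = g u' → u ++ v ∈ L → u' ++ v ∈ L) : L.IsRegular := by
  refine IsRegular.of_finite_range_leftQuotient ?_
  -- The left quotient by `u` can be recovered from the state `g u` alone, so there are at most as
  -- many quotients as states.
  refine (Set.finite_range fun t : τ => {v | ∃ u, g u = t ∧ u ++ v ∈ L}).subset ?_
  rintro _ ⟨u, rfl⟩
  refine ⟨g u, ?_⟩
  ext v
  exact ⟨fun ⟨u', hu, hv⟩ => h _ _ _ hu hv, fun hv => ⟨u, rfl, hv⟩⟩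

theorem IsRegular.congr {L L' : Language α} (hL : L.IsRegular) (h : ∀ w, w ∈ L ↔ w ∈ L') :
    L'.IsRegular :=
  Language.ext h ▸ hL

theorem isRegular_exists_mem (p : α → Prop) : IsRegular {w : List α | ∃ a ∈ w, p a} := by
  refine isRegular_of_finite_states (fun u => ∃ a ∈ u, p a) fun u u' v h => ?_
  have h' := h.to_iff
  change (∃ a ∈ u ++ v, p a) → ∃ a ∈ u' ++ v, p a
  simp only [List.mem_append, or_and_right, exists_or]
  exact Or.imp_left h'.1

/-- Two bits suffice: whether the prefix is still free of the forbidden pattern, and whether it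
contains a `p`. This handles the atom `x ≤ y`: no mark of `y` strictly before a mark of `x`. -/
theorem isRegular_pairwise_not (p q : α → Prop) :
    IsRegular {w : List α | w.Pairwise fun a b => ¬ (p a ∧ q b)} := by
  refine isRegular_of_finite_states
    (fun u => (u.Pairwise fun a b => ¬ (p a ∧ q b), ∃ a ∈ u, p a)) fun u u' v h => ?_
  obtain ⟨h₁, h₂⟩ := Prod.ext_iff.1 h
  change List.Pairwise _ _ → List.Pairwise _ _
  simp only [List.pairwise_append]
  rintro ⟨hu, hv, huv⟩
  refine ⟨h₁.to_iff.1 hu, hv, fun a ha b hb hab => ?_⟩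
  obtain ⟨a', ha', hpa⟩ := h₂.to_iff.2 ⟨a, ha, hab.1⟩
  exact huv a' ha' b hb ⟨hpa, hab.2⟩

theorem IsRegular.preimage_map {L : Language β} (hL : L.IsRegular) (f : α → β) :
    IsRegular {w : List α | w.map f ∈ L} := by
  obtain ⟨σ, _, M, rfl⟩ := hL
  exact ⟨σ, inferInstance, M.comap f, M.accepts_comap f⟩

/-- The image of a regular language under a letter-to-letter relation is regular. -/
theorem IsRegular.image_forall₂ {L : Language α} (hL : L.IsRegular) (R : α → β → Prop) :
    IsRegular {w : List β | ∃ u ∈ L, List.Forall₂ R u w} := by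
  obtain ⟨σ, _, M, rfl⟩ := hL
  -- Subset construction: the state is the set of `M`-states reached by the preimages of the prefix.
  refine isRegular_of_finite_states
    (fun w => {s | ∃ u, List.Forall₂ R u w ∧ M.eval u = s}) fun w w' v h => ?_
  rintro ⟨u, hu, huw⟩
  obtain ⟨u₁, h₁, h₂⟩ : M.eval (u.take w.length) ∈
      {s | ∃ u, List.Forall₂ R u w' ∧ M.eval u = s} := by
    rw [← h]
    exact ⟨_, List.forall₂_take_append _ _ _ huw, rfl⟩
  refine ⟨u₁ ++ u.drop w.length, ?_,
    List.rel_append h₁ (List.forall₂_drop_append _ _ _ huw)⟩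
  rw [← List.take_append_drop w.length u] at hu
  rw [DFA.mem_accepts, DFA.eval, DFA.evalFrom_of_append] at hu ⊢
  rwa [← DFA.eval, h₂]

theorem IsRegular.image_map {L : Language α} (hL : L.IsRegular) (f : α → β) :
    IsRegular {w : List β | ∃ u ∈ L, u.map f = w} := by
  refine (hL.image_forall₂ fun a b => f a = b).congr fun w => ?_
  refine exists_congr fun u => and_congr_right fun _ => ?_
  rw [← List.forall₂_map_left_iff (R := (· = ·)), List.forall₂_eq_eq_eq]

theorem IsRegular.setOf_iff {L L' : Language α} (hL : L.IsRegular) (hL' : L'.IsRegular) :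
    IsRegular {w | w ∈ L ↔ w ∈ L'} := by
  refine (((hL.inf hL'.compl).compl).inf (hL.compl.inf hL').compl).congr fun w => ?_
  change (¬ (w ∈ L ∧ ¬ w ∈ L') ∧ ¬ (¬ w ∈ L ∧ w ∈ L')) ↔ (w ∈ L ↔ w ∈ L')
  tauto

theorem isRegular_univ : IsRegular (Set.univ : Set (List α)) :=
  isRegular_of_finite_states (fun _ => ()) fun _ _ _ _ _ => trivial

theorem isRegular_forall_mem_finset {ι : Type*} (s : Finset ι) {L : ι → Language α}
    (hL : ∀ i ∈ s, (L i).IsRegular) : IsRegular {w | ∀ i ∈ s, w ∈ L i} := by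
  classical
  induction s using Finset.induction_on with
  | empty => exact isRegular_univ.congr fun w => ⟨fun _ i hi => absurd hi (Finset.notMem_empty i),
      fun _ => trivial⟩
  | insert i s _ ih =>
    refine ((hL i (by simp)).inf (ih fun j hj => hL j (by simp [hj]))).congr fun w => ?_
    exact (Finset.forall_mem_insert i s fun j => w ∈ L j).symm

end Language

-- Marking one position of a word, and counting good marks

namespace List

variable {α β : Type*}

/-- The image of a word under `f`, except that the letter at position `p` is mapped by `g`. -/
def mapMark (f g : α → β) (p : ℕ) (w : List α) : List β :=
  w.mapIdx fun i a => if i = p then g a else f a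

@[simp]
theorem length_mapMark (f g : α → β) (p : ℕ) (w : List α) :
    (w.mapMark f g p).length = w.length := by
  simp [mapMark]

theorem mapMark_zero_cons (f g : α → β) (a : α) (w : List α) :
    (a :: w).mapMark f g 0 = g a :: w.map f := by
  refine ext_getElem (by simp [mapMark]) fun i _ _ => ?_
  cases i <;> simp [mapMark]

theorem mapMark_succ_cons (f g : α → β) (p : ℕ) (a : α) (w : List α) :
    (a :: w).mapMark f g (p + 1) = f a :: w.mapMark f g p := by
  simp [mapMark, mapIdx_cons]

theorem lex_append_append_iff {r : α → α → Prop} [Std.Irrefl r] :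
    ∀ {u u' v v' : List α}, u.length = u'.length →
      (Lex r (u ++ v) (u' ++ v') ↔ Lex r u u' ∨ u = u' ∧ Lex r v v')
  | [], [], v, v', _ => by simp
  | a :: u, b :: u', v, v', h => by
    have ih := lex_append_append_iff (r := r) (u := u) (u' := u') (v := v) (v' := v')
      (by simpa using h)
    simp only [cons_append, List.cons_lex_cons_iff, ih, cons.injEq]
    tauto

end List

namespace DFA

variable {α β σ : Type*}

open Classical in
/-- The number of positions of a word whose marking leads from the state `s` into `S`. -/
noncomputable def countMark (M : DFA β σ) (f g : α → β) (S : Set σ) : σ → List α → ℕ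
  | _, [] => 0
  | s, a :: w => (if M.evalFrom (M.step s (g a)) (w.map f) ∈ S then 1 else 0) +
      M.countMark f g S (M.step s (f a)) w

theorem ncard_mapMark (M : DFA β σ) (f g : α → β) (S : Set σ) (s : σ) (w : List α) :
    {p | p < w.length ∧ M.evalFrom s (w.mapMark f g p) ∈ S}.ncard = M.countMark f g S s w := by
  classical
  have key : ∀ (n : ℕ) (Q : ℕ → Prop), {p | p < n ∧ Q p}.ncard = Nat.count Q n := by
    intro n Q
    rw [Nat.count_eq_card_filter_range, ← Set.ncard_coe_finset]
    congr 1
    ext p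
    simp
  rw [key]
  induction w generalizing s with
  | nil => simp [countMark]
  | cons a w ih =>
    rw [List.length_cons, Nat.count_succ', add_comm, countMark]
    simp only [List.mapMark_zero_cons, List.mapMark_succ_cons, evalFrom_cons, ih]

/-- The mark lies in `u` or in `v`. In the first case, sort the marks by the state `t` reached at
the end of `u`; then `v` is read unmarked from `t`. -/
theorem countMark_append [Fintype σ] (M : DFA β σ) (f g : α → β) (S : Set σ) (s : σ)
    (u v : List α) :
    M.countMark f g S s (u ++ v) =
      ∑ t, M.countMark f g {t} s u * (open Classical in if M.evalFrom t (v.map f) ∈ S then 1 else 0)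
        + M.countMark f g S (M.evalFrom s (u.map f)) v := by
  classical
  induction u generalizing s with
  | nil => simp [countMark]
  | cons a u ih =>
    simp only [List.cons_append, countMark, ih, List.map_append, evalFrom_of_append, add_mul,
      Finset.sum_add_distrib, List.map_cons, evalFrom_cons, Set.mem_singleton_iff, ite_mul,
      one_mul, zero_mul, Finset.sum_ite_eq, Finset.mem_univ, if_true, add_assoc]

end DFA

namespace Language

variable {α β : Type*}

/-- Counting, up to a finite congruence of `ℕ`, the marked positions that lead into a regular
language. -/
theorem IsRegular.count_mapMark {L : Language β} (hL : L.IsRegular) (f g : α → β) {τ : Type*}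
    [Finite τ] (q : ℕ → τ) (hq : ∀ a b c, q a = q b → q (a + c) = q (b + c)) (T : Set τ) :
    IsRegular {w : List α | q {p | p < w.length ∧ w.mapMark f g p ∈ L}.ncard ∈ T} := by
  classical
  obtain ⟨σ, _, M, rfl⟩ := hL
  have hq₂ : ∀ a b a' b', q a = q a' → q b = q b' → q (a + b) = q (a' + b') := by
    intro a b a' b' h h'
    rw [hq _ _ _ h, add_comm a' b, hq _ _ _ h', add_comm]
  have hcount : ∀ w : List α, {p | p < w.length ∧ w.mapMark f g p ∈ M.accepts}.ncard =
      M.countMark f g M.accept M.start w := fun w => M.ncard_mapMark f g _ _ w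
  simp only [hcount]
  -- Remember the state on the unmarked prefix and, for each `t`, the class under `q` of the number
  -- of marks in the prefix that lead to `t`.
  refine isRegular_of_finite_states
    (fun u => (M.evalFrom M.start (u.map f), fun t => q (M.countMark f g {t} M.start u)))
    fun u u' v h => ?_
  obtain ⟨h₁, h₂⟩ := Prod.ext_iff.1 h
  have h₁ : M.evalFrom M.start (u.map f) = M.evalFrom M.start (u'.map f) := h₁
  have h₂ : ∀ t, q (M.countMark f g {t} M.start u) = q (M.countMark f g {t} M.start u') :=
    congrFun h₂
  suffices q (M.countMark f g M.accept M.start (u ++ v)) =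
      q (M.countMark f g M.accept M.start (u' ++ v)) by
    change q _ ∈ T → q _ ∈ T
    rw [this]
    exact id
  rw [DFA.countMark_append, DFA.countMark_append, h₁]
  refine hq _ _ _ ?_
  generalize (Finset.univ : Finset σ) = s
  induction s using Finset.induction_on with
  | empty => simp
  | insert t s ht ih =>
    rw [Finset.sum_insert ht, Finset.sum_insert ht]
    refine hq₂ _ _ _ _ ?_ ih
    split_ifs
    · simpa using h₂ t
    · simp

-- Lexicographically least words

/-- The words of `L` that are lexicographically minimal among the words of `L` of their length. -/
def lexMin (r : α → α → Prop) (L : Language α) : Language α :=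
  {w | w ∈ L ∧ ∀ w' ∈ L, w'.length = w.length → ¬ List.Lex r w' w}

/-- Besides the state of the prefix, it suffices to know which states are reached by smaller words
of the same length: a competitor either beats the prefix already, or shares it and wins on the
suffix. -/
theorem IsRegular.lexMin {L : Language α} (hL : L.IsRegular) (r : α → α → Prop) [Std.Irrefl r] :
    (L.lexMin r).IsRegular := by
  obtain ⟨σ, _, M, rfl⟩ := hL
  refine isRegular_of_finite_states
    (fun u => (M.eval u, {s | ∃ x, x.length = u.length ∧ List.Lex r x u ∧ M.eval x = s}))
    fun u u' v h => ?_
  obtain ⟨h₁, h₂⟩ := Prod.ext_iff.1 h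
  have h₁ : M.eval u = M.eval u' := h₁
  have hacc : ∀ x y : List α, x ++ y ∈ M.accepts ↔ M.evalFrom (M.eval x) y ∈ M.accept := by
    intro x y
    rw [DFA.mem_accepts, DFA.eval, DFA.evalFrom_of_append]
  rintro ⟨hu, hmin⟩
  refine ⟨by rwa [hacc, ← h₁, ← hacc], fun w hw hlen hlex => ?_⟩
  rw [List.length_append] at hlen
  rw [← List.take_append_drop u'.length w] at hw hlex
  have hlen₁ : (w.take u'.length).length = u'.length := by simp [hlen]
  have hlen₂ : (w.drop u'.length).length = v.length := by simp [hlen]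
  rw [List.lex_append_append_iff hlen₁] at hlex
  rcases hlex with hlex | ⟨heq, hlex⟩
  · obtain ⟨x, hx, hxu, hxe⟩ : M.eval (w.take u'.length) ∈
        {s | ∃ x, x.length = u.length ∧ List.Lex r x u ∧ M.eval x = s} := by
      rw [show {s | ∃ x, x.length = u.length ∧ List.Lex r x u ∧ M.eval x = s} = _ from h₂]
      exact ⟨_, hlen₁, hlex, rfl⟩
    refine hmin (x ++ w.drop u'.length) ?_ (by simp only [List.length_append]; omega) ?_
    · rwa [hacc, hxe, ← hacc]
    · exact (List.lex_append_append_iff hx).2 (Or.inl hxu)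
  · refine hmin (u ++ w.drop u'.length) ?_ (by simp only [List.length_append]; omega) ?_
    · rwa [hacc, h₁, ← hacc, ← congrArg (· ++ w.drop u'.length) heq]
    · exact (List.lex_append_append_iff rfl).2 (Or.inr ⟨rfl, hlex⟩)

theorem existsUnique_mem_lexMin (r : α → α → Prop) [IsWellOrder α r] {L : Language α} {n : ℕ}
    (h : ∃ w ∈ L, w.length = n) : ∃! w, w ∈ L.lexMin r ∧ w.length = n := by
  -- The lexicographic order need not be well-founded on all words; shortlex is, and both agree at
  -- fixed length.
  obtain ⟨w, ⟨hw, hn⟩, hmin⟩ := (List.Shortlex.wf (r := r) IsWellFounded.wf).has_min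
    {w | w ∈ L ∧ w.length = n} h
  refine ⟨w, ⟨⟨hw, fun w' hw' hlen hlex => ?_⟩, hn⟩, ?_⟩
  · exact hmin w' ⟨hw', hlen.trans hn⟩ (.of_lex hlen hlex)
  · rintro w' ⟨⟨hw', hmin'⟩, hn'⟩
    have hlen := hn'.trans hn.symm
    refine Std.Trichotomous.trichotomous (r := List.Shortlex r) _ _ ?_ ?_
    · exact hmin w' ⟨hw', hn'⟩
    · rw [List.shortlex_iff_lex hlen.symm]
      exact hmin' w hw hlen.symm

end Language

-- Büchi's theorem: formulae to regular languages of encoded models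

namespace AdviceMSO

/-- `P.holds n p` means that the position `p` of a word of length `n` belongs to `P`. -/
def MonadicPredicate.holds (P : MonadicPredicate) (n p : ℕ) : Prop :=
  ∃ h : p < n, (⟨p, h⟩ : Fin n) ∈ P n

/-- A letter together with the truth values, at its position, of the first-order variables, the
second-order variables and the predicate symbols. -/
structure TrackLetter (A : Type*) where
  /-- the letter -/
  sym : A
  /-- the first-order variables whose value is this position -/
  fo : ℕ → Prop
  /-- the second-order variables whose value contains this position -/
  so : ℕ → Prop
  /-- the predicate symbols that hold at this position -/
  pr : ℕ → Prop

/-- Changes the truth value of one first-order variable. -/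
def TrackLetter.setFo {A : Type*} (x : ℕ) (b : Prop) (a : TrackLetter A) : TrackLetter A :=
  { a with fo := Function.update a.fo x b }

namespace Formula

variable {A : Type*}

/-- The word `e` represents the word `w`, the predicates `P` with symbols in `I` and the valuations
`v` and `V` of the first-order and second-order variables in `X` and `Y`. -/
structure Encodes (X Y I : Finset ℕ) (w : List A) (P : ℕ → MonadicPredicate) (v : ℕ → ℕ)
    (V : ℕ → Set ℕ) (e : List (TrackLetter A)) : Prop where
  sym : e.map TrackLetter.sym = w
  lt : ∀ x ∈ X, v x < e.length
  fo : ∀ x ∈ X, ∀ p (h : p < e.length), e[p].fo x ↔ v x = p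
  so : ∀ x ∈ Y, ∀ p (h : p < e.length), e[p].so x ↔ p ∈ V x
  pr : ∀ i ∈ I, ∀ p (h : p < e.length), e[p].pr i ↔ (P i).holds w.length p

variable {X Y I X' Y' I' : Finset ℕ} {w : List A} {P : ℕ → MonadicPredicate} {v : ℕ → ℕ}
  {V : ℕ → Set ℕ} {e : List (TrackLetter A)}

theorem Encodes.length_eq (h : Encodes X Y I w P v V e) : e.length = w.length := by
  rw [← h.sym, List.length_map]

theorem Encodes.mono (h : Encodes X Y I w P v V e) (hX : X' ⊆ X) (hY : Y' ⊆ Y) (hI : I' ⊆ I) :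
    Encodes X' Y' I' w P v V e :=
  ⟨h.sym, fun x hx => h.lt x (hX hx), fun x hx => h.fo x (hX hx), fun x hx => h.so x (hY hx),
    fun x hx => h.pr x (hI hx)⟩

/-- The track of `x` in `e` may hold anything; marking overwrites it at every position. -/
theorem Encodes.mapMark {x p : ℕ} (h : Encodes (X \ {x}) Y I w P v V e) (hp : p < w.length) :
    Encodes X Y I w P (Function.update v x p) V
      (e.mapMark (TrackLetter.setFo x False) (TrackLetter.setFo x True) p) where
  sym := by
    rw [← h.sym]
    refine List.ext_getElem (by simp) fun i _ _ => ?_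
    simp only [List.mapMark, List.getElem_map, List.getElem_mapIdx]
    split_ifs <;> rfl
  lt y hy := by
    rw [List.length_mapMark]
    rcases eq_or_ne y x with rfl | hyx
    · simpa [h.length_eq] using hp
    · simpa [hyx] using h.lt y (by simp [hy, hyx])
  fo y hy i hi := by
    rw [List.length_mapMark] at hi
    simp only [List.mapMark, List.getElem_mapIdx]
    rcases eq_or_ne y x with rfl | hyx
    · split_ifs with hip <;> simp [TrackLetter.setFo, hip, eq_comm (a := p)]
    · have := h.fo y (by simp [hy, hyx]) i hi
      split_ifs <;> simpa [TrackLetter.setFo, hyx] using this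
  so y hy i hi := by
    rw [List.length_mapMark] at hi
    rw [← h.so y hy i hi]
    simp only [List.mapMark, List.getElem_mapIdx]
    split_ifs <;> rfl
  pr y hy i hi := by
    rw [List.length_mapMark] at hi
    rw [← h.pr y hy i hi]
    simp only [List.mapMark, List.getElem_mapIdx]
    split_ifs <;> rfl

/-- Two letters agree except perhaps on the second-order variable `x`. -/
def AgreeExcept (x : ℕ) (a b : TrackLetter A) : Prop :=
  a.sym = b.sym ∧ a.fo = b.fo ∧ (∀ y, y ≠ x → a.so y = b.so y) ∧ a.pr = b.pr

theorem Encodes.exists_update_of_forall₂ {x : ℕ} (h : Encodes X (Y \ {x}) I w P v V e)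
    (Q : List (TrackLetter A) → Prop) :
    (∃ d, Q d ∧ List.Forall₂ (AgreeExcept x) d e) →
      ∃ S ⊆ Set.Iio w.length, ∃ d, Encodes X Y I w P v (Function.update V x S) d ∧ Q d := by
  rintro ⟨d, hd, hR⟩
  have hlen := hR.length_eq
  have hget : ∀ p (h₁ : p < d.length) (h₂ : p < e.length), AgreeExcept x d[p] e[p] := by
    intro p h₁ h₂
    exact (List.forall₂_iff_get.1 hR).2 p h₁ h₂
  refine ⟨{p | ∃ hp : p < d.length, d[p].so x}, ?_, d, ⟨?_, ?_, ?_, ?_, ?_⟩, hd⟩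
  · rintro p ⟨hp, -⟩
    simpa [← h.length_eq, ← hlen] using hp
  · rw [← h.sym]
    exact List.ext_getElem (by simp [hlen]) fun i h₁ h₂ => by
      simpa using (hget i (by simpa using h₁) (by simpa using h₂)).1
  · simpa only [hlen] using h.lt
  · intro y hy p hp
    rw [(hget p hp (hlen ▸ hp)).2.1]
    exact h.fo y hy p _
  · intro y hy p hp
    rcases eq_or_ne y x with rfl | hyx
    · simp [hp]
    · rw [(hget p hp (hlen ▸ hp)).2.2.1 y hyx, Function.update_of_ne hyx]
      exact h.so y (by simp [hy, hyx]) p _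
  · intro y hy p hp
    rw [(hget p hp (hlen ▸ hp)).2.2.2]
    exact h.pr y hy p _

theorem Encodes.exists_agreeExcept {x : ℕ} (h : Encodes X (Y \ {x}) I w P v V e) (S : Set ℕ) :
    ∃ d, Encodes X Y I w P v (Function.update V x S) d ∧ List.Forall₂ (AgreeExcept x) d e := by
  refine ⟨e.mapIdx fun p a => { a with so := Function.update a.so x (p ∈ S) },
    ⟨?_, ?_, ?_, ?_, ?_⟩, ?_⟩
  · rw [← h.sym]
    exact List.ext_getElem (by simp) fun i _ _ => by simp
  · simpa using h.lt
  · intro y hy p hp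
    simpa using h.fo y hy p (by simpa using hp)
  · intro y hy p hp
    rcases eq_or_ne y x with rfl | hyx
    · simp
    · simpa [hyx] using h.so y (by simp [hy, hyx]) p (by simpa using hp)
  · intro y hy p hp
    simpa using h.pr y hy p (by simpa using hp)
  · rw [List.forall₂_iff_get]
    refine ⟨by simp, fun i h₁ h₂ => ?_⟩
    simp only [List.get_eq_getElem, List.getElem_mapIdx]
    exact ⟨rfl, rfl, fun y hy => by simp [hy], rfl⟩

/-- The words that encode models of a formula form a regular language. -/
theorem exists_isRegular_encodes (φ : Formula A) :
    ∃ L : Language (TrackLetter A), L.IsRegular ∧ ∀ w P v V e,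
      Encodes φ.freeVars φ.freeSetVars φ.predSymbols w P v V e → (φ.Sat w P v V ↔ e ∈ L) := by
  induction φ with
  | letter a x =>
    refine ⟨_, Language.isRegular_exists_mem fun t => t.fo x ∧ t.sym = a,
      fun w P v V e h => ?_⟩
    have hlt := h.lt x (by simp [freeVars])
    have hfo := h.fo x (by simp [freeVars])
    change w[v x]? = some a ↔ ∃ t ∈ e, t.fo x ∧ t.sym = a
    rw [← h.sym]
    simp only [List.getElem?_map, List.getElem?_eq_getElem hlt, Option.map_some, Option.some.injEq]
    constructor
    · exact fun h' => ⟨_, List.getElem_mem hlt, (hfo _ hlt).2 rfl, h'⟩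
    · rintro ⟨t, ht, htx, hta⟩
      obtain ⟨p, hp, rfl⟩ := List.getElem_of_mem ht
      obtain rfl := (hfo p hp).1 htx
      exact hta
  | le x y =>
    refine ⟨_, Language.isRegular_pairwise_not
      (fun t : TrackLetter A => t.fo y) (fun t => t.fo x), fun w P v V e h => ?_⟩
    have hx := h.lt x (by simp [freeVars])
    have hy := h.lt y (by simp [freeVars])
    have hfx := h.fo x (by simp [freeVars])
    have hfy := h.fo y (by simp [freeVars])
    change v x ≤ v y ↔ List.Pairwise _ e
    rw [List.pairwise_iff_getElem]
    constructor
    · rintro hle i j hi hj hij ⟨h₁, h₂⟩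
      rw [hfy] at h₁
      rw [hfx] at h₂
      omega
    · intro h'
      by_contra hlt
      exact h' _ _ hy hx (not_le.1 hlt) ⟨(hfy _ hy).2 rfl, (hfx _ hx).2 rfl⟩
  | mem x Z =>
    refine ⟨_, Language.isRegular_exists_mem fun t => t.fo x ∧ t.so Z, fun w P v V e h => ?_⟩
    have hlt := h.lt x (by simp [freeVars])
    have hfo := h.fo x (by simp [freeVars])
    have hso := h.so Z (by simp [freeSetVars])
    change v x ∈ V Z ↔ ∃ t ∈ e, t.fo x ∧ t.so Z
    constructor
    · exact fun h' => ⟨_, List.getElem_mem hlt, (hfo _ hlt).2 rfl, (hso _ hlt).2 h'⟩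
    · rintro ⟨t, ht, htx, htZ⟩
      obtain ⟨p, hp, rfl⟩ := List.getElem_of_mem ht
      obtain rfl := (hfo p hp).1 htx
      exact (hso _ hp).1 htZ
  | pred i x =>
    refine ⟨_, Language.isRegular_exists_mem fun t => t.fo x ∧ t.pr i, fun w P v V e h => ?_⟩
    have hlt := h.lt x (by simp [freeVars])
    have hfo := h.fo x (by simp [freeVars])
    have hpr := h.pr i (by simp [predSymbols])
    change (P i).holds w.length (v x) ↔ ∃ t ∈ e, t.fo x ∧ t.pr i
    constructor
    · exact fun h' => ⟨_, List.getElem_mem hlt, (hfo _ hlt).2 rfl, (hpr _ hlt).2 h'⟩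
    · rintro ⟨t, ht, htx, htZ⟩
      obtain ⟨p, hp, rfl⟩ := List.getElem_of_mem ht
      obtain rfl := (hfo p hp).1 htx
      exact (hpr _ hp).1 htZ
  | and φ ψ ihφ ihψ =>
    obtain ⟨L, hL, hφ⟩ := ihφ
    obtain ⟨L', hL', hψ⟩ := ihψ
    refine ⟨_, hL.inf hL', fun w P v V e h => and_congr (hφ _ _ _ _ _ ?_) (hψ _ _ _ _ _ ?_)⟩
    · exact h.mono Finset.subset_union_left Finset.subset_union_left Finset.subset_union_left
    · exact h.mono Finset.subset_union_right Finset.subset_union_right Finset.subset_union_right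
  | neg φ ih =>
    obtain ⟨L, hL, hφ⟩ := ih
    exact ⟨_, hL.compl, fun w P v V e h => not_congr (hφ _ _ _ _ _ h)⟩
  | ex x φ ih =>
    obtain ⟨L, hL, hφ⟩ := ih
    -- Existence is counting up to the congruence that only separates zero from nonzero, with `Prop`
    -- as its two classes.
    refine ⟨_, hL.count_mapMark (TrackLetter.setFo x False) (TrackLetter.setFo x True)
      (fun n => n = 0) (fun a b e hab => ?_) {False}, fun w P v V e h => ?_⟩
    · simp only [eq_iff_iff] at hab
      simp [hab]
    · change _ ↔ _ = False
      rw [eq_iff_iff, iff_false, Set.ncard_eq_zero ((Set.finite_Iio e.length).subset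
        fun p hp => hp.1), ← ne_eq, ← Set.nonempty_iff_ne_empty]
      simp only [Sat, h.length_eq]
      exact exists_congr fun p => and_congr_right fun hp => hφ _ _ _ _ _ (h.mapMark hp)
  | exSet x φ ih =>
    obtain ⟨L, hL, hφ⟩ := ih
    refine ⟨_, hL.image_forall₂ (AgreeExcept x), fun w P v V e h => ?_⟩
    constructor
    · rintro ⟨S, -, hS⟩
      obtain ⟨d, hd, hR⟩ := h.exists_agreeExcept S
      exact ⟨d, (hφ _ _ _ _ _ hd).1 hS, hR⟩
    · intro he
      obtain ⟨S, hS, d, hd, hdL⟩ := h.exists_update_of_forall₂ (· ∈ L) he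
      exact ⟨S, hS, (hφ _ _ _ _ _ hd).2 hdL⟩
  | exMod r q x φ ih =>
    obtain ⟨L, hL, hφ⟩ := ih
    refine ⟨_, hL.count_mapMark (TrackLetter.setFo x False) (TrackLetter.setFo x True)
      (fun n => (n : ZMod q)) (fun a b e hab => ?_) {(r : ZMod q)}, fun w P v V e h => ?_⟩
    · push_cast
      rw [hab]
    · change _ ↔ (_ : ZMod q) = _
      rw [ZMod.natCast_eq_natCast_iff]
      simp only [Sat, h.length_eq]
      have : {p | p < w.length ∧ φ.Sat w P (Function.update v x p) V} = {p | p < w.length ∧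
          e.mapMark (TrackLetter.setFo x False) (TrackLetter.setFo x True) p ∈ L} :=
        Set.ext fun p => and_congr_right fun hp => hφ _ _ _ _ _ (h.mapMark hp)
      rw [this]

end Formula

end AdviceMSO

-- Predicates as advice words, and their replacement by regular ones

namespace AdviceMSO

theorem MonadicPredicate.mem_language_iff {P : MonadicPredicate} {w : List Bool} :
    w ∈ P.language ↔ ∀ p (h : p < w.length), w[p] = true ↔ P.holds w.length p := by
  constructor
  · exact fun hw p h => (hw ⟨p, h⟩).trans ⟨fun h' => ⟨h, h'⟩, fun ⟨_, h'⟩ => h'⟩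
  · exact fun hw p => (hw p p.2).trans ⟨fun ⟨_, h'⟩ => h', fun h' => ⟨p.2, h'⟩⟩

/-- The word of length `n` whose letters are the truth values of all predicate symbols. -/
def predicateWord (P : ℕ → MonadicPredicate) (n : ℕ) : List (ℕ → Prop) :=
  List.ofFn fun (p : Fin n) i => p ∈ P i n

/-- The predicates whose truth values are the letters of the words `u n`. -/
def predicatesOfWords (u : ℕ → List (ℕ → Prop)) (i : ℕ) : MonadicPredicate :=
  fun n => {p | ∃ h : (p : ℕ) < (u n).length, (u n)[(p : ℕ)] i}

theorem length_predicateWord (P : ℕ → MonadicPredicate) (n : ℕ) :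
    (predicateWord P n).length = n := by
  simp [predicateWord]

theorem getElem_predicateWord (P : ℕ → MonadicPredicate) {n p : ℕ}
    (h : p < (predicateWord P n).length) (i : ℕ) :
    (predicateWord P n)[p] i ↔ (P i).holds n p := by
  have hp : p < n := by rwa [length_predicateWord] at h
  have h' : (predicateWord P n)[p] = fun i => (⟨p, hp⟩ : Fin n) ∈ P i n := List.getElem_ofFn h
  rw [h']
  exact ⟨fun h => ⟨hp, h⟩, fun ⟨_, h⟩ => h⟩

theorem predicateWord_predicatesOfWords {u : ℕ → List (ℕ → Prop)} (hu : ∀ n, (u n).length = n)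
    (n : ℕ) : predicateWord (predicatesOfWords u) n = u n := by
  refine List.ext_getElem (by simp [predicateWord, hu]) fun p h₁ h₂ => ?_
  funext i
  rw [eq_iff_iff, getElem_predicateWord]
  exact ⟨fun ⟨_, _, h⟩ => h, fun h => ⟨hu n ▸ h₂, h₂, h⟩⟩

theorem exists_trackWord {A : Type*} (w : List A) (u : List (ℕ → Prop))
    (h : u.length = w.length) :
    ∃ e : List (TrackLetter A), e.map TrackLetter.sym = w ∧ e.map TrackLetter.pr = u := by
  refine ⟨List.zipWith (fun a b => ⟨a, fun _ => False, fun _ => False, b⟩) w u, ?_, ?_⟩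
  · exact List.ext_getElem (by simp [h]) fun i _ _ => by simp
  · exact List.ext_getElem (by simp [h]) fun i _ _ => by simp

open Classical in
/-- If there is exactly one word of each length in a regular language of words of truth values,
then each of the predicates that these words describe is regular. -/
theorem predicatesOfWords_mem_regularPredicates {u : ℕ → List (ℕ → Prop)}
    {K : Language (ℕ → Prop)} (hK : K.IsRegular) (hlen : ∀ n, (u n).length = n)
    (hu : ∀ w, w ∈ K ↔ w = u w.length) (i : ℕ) :
    predicatesOfWords u i ∈ regularPredicates := by
  refine (hK.image_map fun b => decide (b i)).congr fun w => ?_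
  have hholds : ∀ n p (h : p < n),
      (predicatesOfWords u i).holds n p ↔ ((u n)[p]'(by rwa [hlen])) i := by
    intro n p h
    exact ⟨fun ⟨_, _, h⟩ => h, fun h' => ⟨h, by rwa [hlen], h'⟩⟩
  rw [MonadicPredicate.mem_language_iff]
  constructor
  · rintro ⟨x, hx, rfl⟩ p hp
    rw [hholds _ _ hp]
    have hux : u (x.map fun b => decide (b i)).length = x := by
      rw [List.length_map]
      exact ((hu x).1 hx).symm
    rw [List.getElem_of_eq hux, List.getElem_map, decide_eq_true_eq]
  · intro h
    refine ⟨u w.length, (hu _).2 (by rw [hlen]), ?_⟩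
    refine List.ext_getElem (by simp [hlen]) fun p h₁ h₂ => ?_
    rw [Bool.eq_iff_iff, h p h₂, hholds _ _ h₂]
    simp

namespace Formula

variable {A : Type*} {φ : Formula A}

/-- The language of a sentence is obtained from a regular language of words with predicates. -/
theorem IsSentence.exists_isRegular (hφ : φ.IsSentence) :
    ∃ M : Language (TrackLetter A), M.IsRegular ∧ ∀ P e,
      (∀ i ∈ φ.predSymbols, ∀ p (h : p < e.length), e[p].pr i ↔ (P i).holds e.length p) →
        (e.map TrackLetter.sym ∈ φ.language P ↔ e ∈ M) := by
  obtain ⟨M, hM, h⟩ := exists_isRegular_encodes φ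
  refine ⟨M, hM, fun P e he => h _ P _ _ e ⟨rfl, ?_, ?_, ?_, by simpa using he⟩⟩
  · simp [hφ.1]
  · simp [hφ.1]
  · simp [hφ.2]

theorem pr_iff_holds_of_map_eq {P : ℕ → MonadicPredicate} {e : List (TrackLetter A)}
    (h : e.map TrackLetter.pr = predicateWord P e.length) (i p : ℕ) (hp : p < e.length) :
    e[p].pr i ↔ (P i).holds e.length p := by
  rw [← getElem_predicateWord P (by rwa [length_predicateWord]), ← List.getElem_of_eq h (by simpa),
    List.getElem_map]

-- Guess the predicate tracks, check them and project to the letters. Only the finitely many symbols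
-- of the sentence are checked.
open Classical in
theorem IsSentence.isRegular_language (hφ : φ.IsSentence) {P : ℕ → MonadicPredicate}
    (hP : ∀ i ∈ φ.predSymbols, P i ∈ regularPredicates) : (φ.language P).IsRegular := by
  obtain ⟨M, hM, hφM⟩ := hφ.exists_isRegular
  have hI : Language.IsRegular {e : List (TrackLetter A) | ∀ i ∈ φ.predSymbols,
      e ∈ ({e | e.map (fun a => decide (a.pr i)) ∈ (P i).language} : Language _)} :=
    Language.isRegular_forall_mem_finset _ fun i hi => (hP i hi).preimage_map _
  refine ((hM.inf hI).image_map TrackLetter.sym).congr fun w => ?_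
  constructor
  · rintro ⟨e, ⟨hcM, hcI⟩, rfl⟩
    refine (hφM P e fun i hi p hp => ?_).2 hcM
    have := MonadicPredicate.mem_language_iff.1 (hcI i hi) p (by simpa using hp)
    simpa using this
  · intro hw
    obtain ⟨e, rfl, he⟩ := exists_trackWord w (predicateWord P w.length) (length_predicateWord _ _)
    rw [List.length_map] at he
    have hpr := pr_iff_holds_of_map_eq he
    refine ⟨e, ⟨(hφM P e fun i _ => hpr i).1 hw, fun i _ => ?_⟩, rfl⟩
    refine MonadicPredicate.mem_language_iff.2 fun p hp => ?_
    simpa using hpr i p (by simpa using hp)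

/-- If a sentence defines a regular language, its predicates may be replaced by regular ones. -/
theorem IsSentence.exists_regularPredicates (hφ : φ.IsSentence) {P : ℕ → MonadicPredicate}
    (hL : (φ.language P).IsRegular) :
    ∃ P' : ℕ → MonadicPredicate, (∀ i, P' i ∈ regularPredicates) ∧
      φ.language P' = φ.language P := by
  obtain ⟨M, hM, hφM⟩ := hφ.exists_isRegular
  -- The good advice words; the universal quantifier over inputs is written as complement,
  -- projection, complement.
  set K : Language (ℕ → Prop) := {u | ∃ e ∈ ({e | e.map TrackLetter.sym ∈ φ.language P ↔ e ∈ M}ᶜ :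
    Language (TrackLetter A)), e.map TrackLetter.pr = u}ᶜ
  have hK : K.IsRegular :=
    (((hL.preimage_map TrackLetter.sym).setOf_iff hM).compl.image_map TrackLetter.pr).compl
  have hmem : ∀ u, u ∈ K ↔ ∀ e : List (TrackLetter A), e.map TrackLetter.pr = u →
      (e.map TrackLetter.sym ∈ φ.language P ↔ e ∈ M) := by
    intro u
    change (¬ ∃ e, ¬ (_ ↔ _) ∧ _) ↔ _
    rw [not_exists]
    exact forall_congr' fun e => ⟨fun h h' => by_contra fun h'' => h ⟨h'', h'⟩,
      fun h h' => h'.1 (h h'.2)⟩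
  have hne : ∀ n, ∃ u ∈ K, u.length = n := by
    refine fun n => ⟨predicateWord P n, (hmem _).2 fun e he => ?_, length_predicateWord P n⟩
    obtain rfl : e.length = n := by
      rw [← length_predicateWord P n, ← he, List.length_map]
    exact hφM P e fun i _ => pr_iff_holds_of_map_eq he i
  choose u hu huniq using fun n =>
    Language.existsUnique_mem_lexMin (WellOrderingRel (α := ℕ → Prop)) (hne n)
  have hlen : ∀ n, (u n).length = n := fun n => (hu n).2
  refine ⟨predicatesOfWords u, predicatesOfWords_mem_regularPredicates
    (hK.lexMin WellOrderingRel) hlen fun w => ⟨fun hw => huniq _ w ⟨hw, rfl⟩, fun hw => ?_⟩, ?_⟩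
  · rw [hw]
    exact (hu _).1
  · refine Language.ext fun w => ?_
    obtain ⟨e, rfl, he⟩ := exists_trackWord w (u w.length) (hlen _)
    rw [List.length_map] at he
    -- As the advice is good, membership in the old language means `e ∈ M`; by `hφM` so does
    -- membership in the new one.
    rw [(hmem _).1 (hu e.length).1.1 e he]
    refine hφM _ e fun i _ => pr_iff_holds_of_map_eq ?_ i
    rw [he, predicateWord_predicatesOfWords hlen]

end Formula

theorem straubingProperty_univ {A : Type*} (F : Set (Formula A)) :
    StraubingProperty F Set.univ := by
  ext L
  constructor
  · rintro ⟨⟨φ, hF, hφ, P, -, rfl⟩, hL⟩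
    obtain ⟨P', hP', h⟩ := hφ.exists_regularPredicates hL
    exact ⟨φ, hF, hφ, P', fun i _ => ⟨trivial, hP' i⟩, h⟩
  · rintro ⟨φ, hF, hφ, P, hP, rfl⟩
    exact ⟨⟨φ, hF, hφ, P, fun _ _ => trivial, rfl⟩,
      hφ.isRegular_language fun i hi => (hP i hi).2⟩

end AdviceMSO

theorem mainTheorem4 {A : Type*} [Finite A] :
    (∀ F : Set (AdviceMSO.Formula A), AdviceMSO.StraubingProperty F Set.univ) ∧
    (∀ k : ℕ, 1 ≤ k → AdviceMSO.StraubingProperty (AdviceMSO.BoolSigma A k) Set.univ) :=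
  ⟨fun F => AdviceMSO.straubingProperty_univ F, fun _ _ => AdviceMSO.straubingProperty_univ _⟩
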